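/- Let $d\ge 1$ be an integer and $\kappa\ge 1$. There is a constant $C>0$ depending only on $d$ and $\kappa$ such that the following holds. Let $\|\cdot\|$ be any norm on $\mathbb R^d$ with $\mathbf S_+:=\{u\in[0,\infty)^d:\|u\|=1\}\subseteq[0,1]^d$ and $\|e_j\|\le\kappa$ for every vector $e_j$ of the canonical basis (thus $C$ depends only on $d$ if $\|e_j\|=1$ for all $j$, as for the $\ell^p$ norms). Let $\alpha>0$, and let $\nu$ be a finite measure on $\mathbf S_+$ with $\int u^j\,d\nu(u)=1$ for $j=1,\dots,d$. Powers and suprema of vectors, and the order on vectors, are taken coordinatewise. Let $Z\sim\mathrm{MS}(\alpha,\nu)$, that is, $Z$ is a random vector with the same law as $\sup_i y_i$, where $(y_i)_{i\ge1}$ are the points of a Poisson process on $[0,\infty)^d\setminus\{0\}$ whose intensity is the image of $\alpha r^{-(\alpha+1)}\mathbf 1_{r>0}\,dr\otimes\nu(du)$ under $(r,u)\mapsto r u^{1/\alpha}$. Assume that $Z$ has a bounded density with respect to Lebesgue measure on $\mathbb R^d$. Let $(r_i,v_i)_{i\ge 1}$, with $r_1\ge r_2\ge\cdots$, be the points of a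 Poisson process with intensity $\alpha r^{-(\alpha+1)}\mathbf 1_{r>0}\,dr\otimes\nu_\alpha(dv)$, where $\nu_\alpha$ is the image of $\nu$ under $u\mapsto u^{1/\alpha}$, and let $Z_n:=\max_{1\le i\le n} r_i v_i$ be the partial de Haan--LePage series. Then, for all $n\ge2$, $$ d_{\mathrm{Kol}}(Z_n,Z):=\sup_{z\in(0,\infty)^d}\bigl|\mathbb P(Z_n\le z)-\mathbb P(Z\le z)\bigr|\;\le\; C\Bigl(\frac{\log n}{n}\Bigr)^{2/3}. $$ -/

import Mathlib

open MeasureTheory ProbabilityTheory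

noncomputable section

namespace LePage

/-- The number of indices `i` such that the point `ξ i` lies in `B` (points are counted with
multiplicity; the value may be infinite). -/
def pointCount {X : Type*} (ξ : ℕ → X) (B : Set X) : ℕ∞ :=
  Set.encard {i : ℕ | ξ i ∈ B}

/-- The random points `ξ 0, ξ 1, …` are the points of a Poisson process with intensity measure
`lam`: the number of points in a measurable set `B` has the Poisson law with parameter `lam B`
(it is almost surely infinite if `lam B = ∞`), and the numbers of points in pairwise disjoint
measurable sets are independent. -/
structure IsPoissonProcess {Ω X : Type*} [MeasurableSpace Ω] [MeasurableSpace X]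
    (P : Measure Ω) (ξ : ℕ → Ω → X) (lam : Measure X) : Prop where
  measurable : ∀ i, Measurable (ξ i)
  count_law : ∀ B : Set X, MeasurableSet B → lam B ≠ ⊤ →
    P.map (fun ω => pointCount (fun i => ξ i ω) B)
      = (poissonMeasure (lam B).toNNReal).map (fun k : ℕ => (k : ℕ∞))
  count_top : ∀ B : Set X, MeasurableSet B → lam B = ⊤ →
    ∀ᵐ ω ∂P, pointCount (fun i => ξ i ω) B = ⊤
  count_indep : ∀ (k : ℕ) (B : Fin k → Set X), (∀ a, MeasurableSet (B a)) →
    Pairwise (fun a b => Disjoint (B a) (B b)) →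
    iIndepFun (fun a ω => pointCount (fun i => ξ i ω) (B a)) P

/-- The positive orthant of the unit sphere of the norm `N` on `ℝ^d`. -/
def posSphere {d : ℕ} (N : Seminorm ℝ (Fin d → ℝ)) : Set (Fin d → ℝ) :=
  {u | (∀ j, 0 ≤ u j) ∧ N u = 1}

/-- `N` is a reference norm: a norm on `ℝ^d`, normalized so that the positive orthant of its unit
sphere is contained in `[0,1]^d`. -/
structure IsReferenceNorm {d : ℕ} (N : Seminorm ℝ (Fin d → ℝ)) : Prop where
  definite : ∀ x, N x = 0 → x = 0
  normalized : posSphere N ⊆ {u | ∀ j, 0 ≤ u j ∧ u j ≤ 1}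

/-- `ν` is an angular measure: a finite measure carried by the positive orthant of the unit
sphere, each of whose coordinate moments is equal to one. -/
structure IsAngularMeasure {d : ℕ} (N : Seminorm ℝ (Fin d → ℝ)) (ν : Measure (Fin d → ℝ)) :
    Prop where
  finite : IsFiniteMeasure ν
  carried : ν (posSphere N)ᶜ = 0
  moment : ∀ j, ∫ u, u j ∂ν = 1

/-- The measure `α r^{-(α+1)} dr` on `(0, ∞)`; it gives mass `x^{-α}` to `[x, ∞)` for `x > 0`. -/
def radialMeasure (α : ℝ) : Measure ℝ :=
  (volume.restrict (Set.Ioi 0)).withDensity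
    (fun r => ENNReal.ofReal (α * r ^ (-(α + 1))))

/-- The coordinatewise power `x^a`. -/
def coordPow {d : ℕ} (a : ℝ) (x : Fin d → ℝ) : Fin d → ℝ := fun j => x j ^ a

/-- The image `ν_α` of the angular measure by `u ↦ u^{1/α}`. -/
def powAngular {d : ℕ} (α : ℝ) (ν : Measure (Fin d → ℝ)) : Measure (Fin d → ℝ) :=
  ν.map (coordPow (1 / α))

/-- The exponent measure with stability index `α` and angular measure `ν`: the image of
`α r^{-(α+1)} dr ⊗ ν(du)` by `(r, u) ↦ r u^{1/α}`. -/
def exponentMeasure {d : ℕ} (α : ℝ) (ν : Measure (Fin d → ℝ)) : Measure (Fin d → ℝ) :=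
  ((radialMeasure α).prod ν).map (fun p => p.1 • coordPow (1 / α) p.2)

/-- `m` is the max-stable law `MS(α, ν)`: it is the law of the coordinatewise supremum of the
points of a Poisson process whose intensity is the exponent measure of `(α, ν)`. -/
def IsMaxStableLaw {d : ℕ} (α : ℝ) (ν : Measure (Fin d → ℝ)) (m : Measure (Fin d → ℝ)) : Prop :=
  ∃ (Ω : Type) (_ : MeasurableSpace Ω) (P : Measure Ω) (_ : IsProbabilityMeasure P)
    (y : ℕ → Ω → (Fin d → ℝ)),
    IsPoissonProcess P y (exponentMeasure α ν) ∧
      m = P.map (fun ω j => ⨆ i : ℕ, y i ω j)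

/-- The maximum of the first `n` terms: coordinatewise maximum of `r_i v_i` for `i < n`. -/
def partialMax {d : ℕ} (n : ℕ) (φ : ℕ → ℝ × (Fin d → ℝ)) : Fin d → ℝ :=
  fun j => ⨆ i : Fin n, (φ i).1 * (φ i).2 j

/-- `η = ((r_i, v_i))_i` is a marked Poisson process with intensity
`α r^{-(α+1)} dr ⊗ ν_α(dv)`, numbered so that `r_0 ≥ r_1 ≥ …`. -/
structure IsLePagePointProcess {Ω : Type*} [MeasurableSpace Ω] {d : ℕ} (P : Measure Ω)
    (α : ℝ) (ν : Measure (Fin d → ℝ)) (η : ℕ → Ω → ℝ × (Fin d → ℝ)) : Prop where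
  poisson : IsPoissonProcess P η ((radialMeasure α).prod (powAngular α ν))
  ordered : ∀ᵐ ω ∂P, Antitone (fun i => (η i ω).1)

/-- The law `m` has a bounded density with respect to the Lebesgue measure on `ℝ^d`. -/
def HasBoundedDensity {d : ℕ} (m : Measure (Fin d → ℝ)) : Prop :=
  ∃ (f : (Fin d → ℝ) → ENNReal) (K : NNReal), Measurable f ∧ (∀ x, f x ≤ (K : ENNReal)) ∧
    m = (volume : Measure (Fin d → ℝ)).withDensity f

/-- The Kolmogorov distance between two laws on `ℝ^d`: the supremum over `z ∈ (0, ∞)^d` of the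
distance between the distribution functions at `z`. -/
def dKol {d : ℕ} (m₁ m₂ : Measure (Fin d → ℝ)) : ℝ :=
  ⨆ z : {z : Fin d → ℝ // ∀ j, 0 < z j}, |m₁.real (Set.Iic z.1) - m₂.real (Set.Iic z.1)|

/-- The supremum in `dKol` is over a bounded set. -/
theorem bddAbove_dKol {d : ℕ} (m₁ m₂ : Measure (Fin d → ℝ)) [IsProbabilityMeasure m₁]
    [IsProbabilityMeasure m₂] :
    BddAbove (Set.range fun z : {z : Fin d → ℝ // ∀ j, 0 < z j} =>
      |m₁.real (Set.Iic z.1) - m₂.real (Set.Iic z.1)|) := by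
  refine ⟨1, ?_⟩
  rintro _ ⟨z, rfl⟩
  have h1 : m₁.real (Set.Iic z.1) ≤ 1 := measureReal_le_one
  have h2 : m₂.real (Set.Iic z.1) ≤ 1 := measureReal_le_one
  have h3 : 0 ≤ m₁.real (Set.Iic z.1) := measureReal_nonneg
  have h4 : 0 ≤ m₂.real (Set.Iic z.1) := measureReal_nonneg
  exact abs_le.2 ⟨by linarith, by linarith⟩

end LePage

end

namespace LePage

/-! Both distribution functions at `z` are avoidance probabilities of the exceedance set `B = {(r,
v) : r v ≰ z}` by one Poisson process: `Z ≤ z` means that no point falls in `B`, `Z_n ≤ z` that none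
of the first `n` does. The error is thus the probability that `B` is hit, but only after index `n`.
Cut at a radius `x` with `x^(-α)` a small multiple of `n`. The number of radii above `x` is Poisson
with mean at most `n/4`, so it exceeds `n` with exponentially small probability
(`poissonMeasure_real_Ioi_le`); otherwise all these points are among the first `n`. If `z ≥ x`
coordinatewise, only they can hit `B`, since marks lie in `[0,1]^d`. If some `z j < x`, they hit `B`
except with probability at most `exp(-x^(-α))`, by the moment condition (`le_prod_radialMeasure`).
The resulting exponential bound, `abs_sub_le`, is weakened to order `1/n`, which is below the stated
rate. -/

theorem radialMeasure_Ioi {α x : ℝ} (hα : 0 < α) (hx : 0 < x) :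
    radialMeasure α (Set.Ioi x) = ENNReal.ofReal (x ^ (-α)) := by
  have hsub : Set.Ioi x ∩ Set.Ioi 0 = Set.Ioi x :=
    Set.inter_eq_left.2 (Set.Ioi_subset_Ioi hx.le)
  have hint : IntegrableOn (fun r : ℝ => α * r ^ (-(α + 1))) (Set.Ioi x) :=
    (integrableOn_Ioi_rpow_of_lt (by linarith) hx).const_mul α
  rw [radialMeasure, withDensity_apply _ measurableSet_Ioi, Measure.restrict_restrict
    measurableSet_Ioi, hsub, ← ofReal_integral_eq_lintegral_ofReal hint]
  · rw [integral_const_mul, integral_Ioi_rpow_of_lt (by linarith) hx]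
    congr 1
    have : -(α + 1) + 1 = -α := by ring
    rw [this]
    field_simp
  · filter_upwards [ae_restrict_mem measurableSet_Ioi] with r hr
    have : 0 < r := hx.trans hr
    positivity

instance sFinite_radialMeasure (α : ℝ) : SFinite (radialMeasure α) := by
  unfold radialMeasure; infer_instance

theorem measurable_coordPow {d : ℕ} (a : ℝ) : Measurable (coordPow (d := d) a) := by
  unfold coordPow; fun_prop

/-- This transfers the max-stable law to the intensity of the marked process, so that both laws are
compared through the same exceedance set. -/
theorem exponentMeasure_eq_map {d : ℕ} (α : ℝ) (ν : Measure (Fin d → ℝ)) [IsFiniteMeasure ν] :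
    exponentMeasure α ν
      = ((radialMeasure α).prod (powAngular α ν)).map (fun p => p.1 • p.2) := by
  have hc := measurable_coordPow (d := d) (1 / α)
  have h := Measure.map_prod_map (radialMeasure α) ν measurable_id hc
  rw [Measure.map_id] at h
  rw [exponentMeasure, powAngular, h, Measure.map_map (by fun_prop) (by fun_prop)]
  rfl

instance isFiniteMeasure_powAngular {d : ℕ} (α : ℝ) (ν : Measure (Fin d → ℝ))
    [IsFiniteMeasure ν] : IsFiniteMeasure (powAngular α ν) := by
  unfold powAngular; infer_instance

/-! ### Mass bounds for the angular measure and the marked intensity -/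

section Angular

variable {d : ℕ} {N : Seminorm ℝ (Fin d → ℝ)} {ν : Measure (Fin d → ℝ)}

theorem IsAngularMeasure.ae_mem (hν : IsAngularMeasure N ν) : ∀ᵐ u ∂ν, u ∈ posSphere N :=
  hν.carried

theorem IsAngularMeasure.integrable (hν : IsAngularMeasure N ν) (j : Fin d) :
    Integrable (fun u : Fin d → ℝ => u j) ν :=
  .of_integral_ne_zero (by rw [hν.moment j]; exact one_ne_zero)

/-- The angular measure has mass at most `κ d` if the basis vectors have norm at most `κ`. -/
theorem IsAngularMeasure.real_univ_le (hν : IsAngularMeasure N ν) {κ : ℝ}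
    (hκ : ∀ j, N (Pi.single j 1) ≤ κ) : ν.real Set.univ ≤ κ * d := by
  have := hν.finite
  -- Triangle inequality in the canonical basis; integrating it against the unit moments bounds the
  -- mass.
  have hle : ∀ᵐ u ∂ν, (1 : ℝ) ≤ ∑ j, κ * u j := by
    filter_upwards [hν.ae_mem] with u hu
    have hsum : u = ∑ j, u j • Pi.single j (1 : ℝ) := by
      ext i; simp [Finset.sum_apply, Pi.single_apply]
    calc (1 : ℝ) = N u := hu.2.symm
      _ = N (∑ j, u j • Pi.single j (1 : ℝ)) := by rw [← hsum]
      _ ≤ ∑ j, N (u j • Pi.single j (1 : ℝ)) :=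
        Finset.le_sum_of_subadditive N (map_zero N).le (map_add_le_add N) _ _
      _ ≤ ∑ j, κ * u j := by
        refine Finset.sum_le_sum fun j _ => ?_
        rw [map_smul_eq_mul, Real.norm_of_nonneg (hu.1 j), mul_comm]
        exact mul_le_mul_of_nonneg_right (hκ j) (hu.1 j)
  have hint : ∀ j ∈ Finset.univ, Integrable (fun u : Fin d → ℝ => κ * u j) ν :=
    fun j _ => (hν.integrable j).const_mul κ
  calc ν.real Set.univ = ∫ _, (1 : ℝ) ∂ν := by simp
    _ ≤ ∫ u, ∑ j, κ * u j ∂ν :=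
      integral_mono_ae (integrable_const _) (integrable_finsetSum _ hint) hle
    _ = κ * d := by
      rw [integral_finsetSum _ hint]
      simp [integral_const_mul, hν.moment, mul_comm]

variable {α : ℝ}

theorem IsAngularMeasure.ae_powAngular (hN : IsReferenceNorm N) (hν : IsAngularMeasure N ν)
    (hα : 0 < α) : ∀ᵐ v ∂powAngular α ν, ∀ j, 0 ≤ v j ∧ v j ≤ 1 := by
  rw [powAngular, ae_map_iff (measurable_coordPow _).aemeasurable (by measurability)]
  filter_upwards [hν.ae_mem] with u hu j
  have h := hN.normalized hu j
  exact ⟨Real.rpow_nonneg h.1 _, Real.rpow_le_one h.1 h.2 (by positivity)⟩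

theorem IsAngularMeasure.lintegral_rpow_powAngular (hν : IsAngularMeasure N ν) (hα : 0 < α)
    (j : Fin d) : ∫⁻ v, ENNReal.ofReal (v j ^ α) ∂powAngular α ν = 1 := by
  have hnn : ∀ᵐ u ∂ν, 0 ≤ u j := hν.ae_mem.mono fun u hu => hu.1 j
  rw [powAngular, lintegral_map (by fun_prop) (measurable_coordPow _)]
  calc ∫⁻ u, ENNReal.ofReal (coordPow (1 / α) u j ^ α) ∂ν = ∫⁻ u, ENNReal.ofReal (u j) ∂ν := by
        refine lintegral_congr_ae (hnn.mono fun u hu => ?_)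
        simp only [coordPow]
        rw [← Real.rpow_mul hu, one_div_mul_cancel hα.ne', Real.rpow_one]
    _ = 1 := by
        rw [← ofReal_integral_eq_lintegral_ofReal (hν.integrable j) hnn, hν.moment j,
          ENNReal.ofReal_one]

theorem powAngular_univ (α : ℝ) (ν : Measure (Fin d → ℝ)) :
    powAngular α ν Set.univ = ν Set.univ := by
  rw [powAngular, Measure.map_apply (measurable_coordPow _) .univ, Set.preimage_univ]

theorem prod_radialMeasure_lt_fst [IsFiniteMeasure ν] (hα : 0 < α) {x : ℝ} (hx : 0 < x) :
    ((radialMeasure α).prod (powAngular α ν)) {p | x < p.1}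
      = ENNReal.ofReal (x ^ (-α) * ν.real Set.univ) := by
  have : {p : ℝ × (Fin d → ℝ) | x < p.1} = Set.Ioi x ×ˢ Set.univ := by ext; simp
  rw [this, Measure.prod_prod, radialMeasure_Ioi hα hx, powAngular_univ,
    ENNReal.ofReal_mul (by positivity), ofReal_measureReal]

/-- For a fixed mark with `0 < v j ≤ 1`, the radii `r > x / v j` already satisfy `r > x` and have
mass `x^(-α) (v j)^α`; the moment condition makes these integrate to `x^(-α)`. -/
theorem IsAngularMeasure.le_prod_radialMeasure (hN : IsReferenceNorm N)
    (hν : IsAngularMeasure N ν) (hα : 0 < α) {x : ℝ} (hx : 0 < x) (j : Fin d) :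
    ENNReal.ofReal (x ^ (-α)) ≤ ((radialMeasure α).prod (powAngular α ν))
      {p | x < p.1 ∧ x < p.1 * p.2 j} := by
  have := hν.finite
  have hS : MeasurableSet {p : ℝ × (Fin d → ℝ) | x < p.1 ∧ x < p.1 * p.2 j} := by
    have h1 : MeasurableSet {p : ℝ × (Fin d → ℝ) | x < p.1} :=
      measurableSet_lt measurable_const measurable_fst
    have h2 : MeasurableSet {p : ℝ × (Fin d → ℝ) | x < p.1 * p.2 j} :=
      measurableSet_lt measurable_const (by fun_prop)
    exact h1.inter h2
  rw [Measure.prod_apply_symm hS]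
  calc ENNReal.ofReal (x ^ (-α))
      = ENNReal.ofReal (x ^ (-α)) * ∫⁻ v, ENNReal.ofReal (v j ^ α) ∂powAngular α ν := by
        rw [hν.lintegral_rpow_powAngular hα, mul_one]
    _ = ∫⁻ v, ENNReal.ofReal (x ^ (-α)) * ENNReal.ofReal (v j ^ α) ∂powAngular α ν := by
        have hm : Measurable fun v : Fin d → ℝ => ENNReal.ofReal (v j ^ α) := by fun_prop
        rw [lintegral_const_mul _ hm]
    _ ≤ _ := by
        refine lintegral_mono_ae ?_
        filter_upwards [hν.ae_powAngular hN hα] with v hv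
        rcases (hv j).1.eq_or_lt with h0 | h0
        · simp [← h0, Real.zero_rpow hα.ne']
        · calc ENNReal.ofReal (x ^ (-α)) * ENNReal.ofReal (v j ^ α)
              = radialMeasure α (Set.Ioi (x / v j)) := by
                rw [radialMeasure_Ioi hα (by positivity), ← ENNReal.ofReal_mul (by positivity),
                  Real.div_rpow hx.le h0.le, Real.rpow_neg h0.le, div_inv_eq_mul]
            _ ≤ _ := by
                refine measure_mono fun r hr => ?_
                have hr' : x < r * v j := (div_lt_iff₀ h0).1 hr
                have : x ≤ x / v j := le_div_self hx.le h0 (hv j).2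
                exact ⟨this.trans_lt hr, hr'⟩

/-- Points with radius at most `x` cannot exceed a level all of whose coordinates are at
least `x`. -/
theorem IsAngularMeasure.prod_radialMeasure_exceed_eq_zero (hN : IsReferenceNorm N)
    (hν : IsAngularMeasure N ν) (hα : 0 < α) {x : ℝ} {z : Fin d → ℝ} (hz : ∀ j, 0 < z j)
    (hxz : ∀ j, x ≤ z j) :
    ((radialMeasure α).prod (powAngular α ν)) ({p | ∃ j, z j < p.1 * p.2 j} \ {p | x < p.1})
      = 0 := by
  have := hν.finite
  refine measure_mono_null (t := Set.univ ×ˢ {v | ∀ j, 0 ≤ v j ∧ v j ≤ 1}ᶜ) ?_ ?_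
  · rintro ⟨r, v⟩ ⟨⟨j, hj⟩, hr⟩
    simp only [Set.mem_ofPred_eq, not_lt] at hj hr
    refine ⟨trivial, fun hv => absurd hj (not_lt.2 ?_)⟩
    rcases le_total r 0 with h0 | h0
    · exact (mul_nonpos_of_nonpos_of_nonneg h0 (hv j).1).trans (hz j).le
    · exact (mul_le_of_le_one_right h0 (hv j).2).trans (hr.trans (hxz j))
  · rw [Measure.prod_prod, show powAngular α ν {v | ∀ j, 0 ≤ v j ∧ v j ≤ 1}ᶜ = 0 from
      hν.ae_powAngular hN hα, mul_zero]

theorem measurableSet_exceed (z : Fin d → ℝ) :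
    MeasurableSet {p : ℝ × (Fin d → ℝ) | ∃ j, z j < p.1 * p.2 j} := by
  simp only [Set.ofPred_exists]
  exact .iUnion fun j => measurableSet_lt measurable_const (by fun_prop)

theorem measurableSet_lt_fst (x : ℝ) : MeasurableSet {p : ℝ × (Fin d → ℝ) | x < p.1} :=
  measurableSet_lt measurable_const measurable_fst

theorem IsAngularMeasure.prod_radialMeasure_exceed_ne_top (hN : IsReferenceNorm N)
    (hν : IsAngularMeasure N ν) (hα : 0 < α) {z : Fin d → ℝ} (hz : ∀ j, 0 < z j) :
    ((radialMeasure α).prod (powAngular α ν)) {p | ∃ j, z j < p.1 * p.2 j} ≠ ⊤ := by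
  have := hν.finite
  obtain ⟨x, hx, hxz⟩ : ∃ x, 0 < x ∧ ∀ j, x ≤ z j := by
    rcases isEmpty_or_nonempty (Fin d) with h | h
    · exact ⟨1, one_pos, fun j => h.elim j⟩
    · obtain ⟨i, hi⟩ := Finite.exists_min z
      exact ⟨z i, hz i, hi⟩
  have h : ((radialMeasure α).prod (powAngular α ν)) {p | ∃ j, z j < p.1 * p.2 j} ≤
      ((radialMeasure α).prod (powAngular α ν)) {p | x < p.1} := by
    rw [← measure_inter_add_sdiff _ (measurableSet_lt_fst x),
      hν.prod_radialMeasure_exceed_eq_zero hN hα hz hxz, add_zero]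
    exact measure_mono Set.inter_subset_right
  refine ne_top_of_le_ne_top ?_ h
  rw [prod_radialMeasure_lt_fst hα hx]
  exact ENNReal.ofReal_ne_top

end Angular

/-! ### Poisson counts: tails and avoidance probabilities -/

/-- Chernoff bound with base 2: `1 ≤ 2^(k - n)` for `k > n`, and `2^X` has mean `exp l`. -/
theorem poissonMeasure_real_Ioi_le (l : NNReal) (n : ℕ) :
    (poissonMeasure l).real (Set.Ioi n) ≤ Real.exp l / 2 ^ n := by
  have hs := NormedSpace.expSeries_div_hasSum_exp (2 * l : ℝ)
  rw [← Real.exp_eq_exp_ℝ] at hs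
  have hs' := hs.mul_left (Real.exp (-l) / 2 ^ n)
  have hval : Real.exp (-l) / 2 ^ n * Real.exp (2 * l) = Real.exp l / 2 ^ n := by
    rw [div_mul_eq_mul_div, ← Real.exp_add]; congr 2; ring
  rw [hval] at hs'
  have hle : poissonMeasure l (Set.Ioi n) ≤ ENNReal.ofReal (Real.exp l / 2 ^ n) := by
    rw [← hs'.tsum_eq, ENNReal.ofReal_tsum_of_nonneg (fun k => by positivity) hs'.summable,
      ← Measure.tsum_indicator_apply_singleton _ _ measurableSet_Ioi]
    refine ENNReal.tsum_le_tsum fun k => ?_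
    by_cases hk : k ∈ Set.Ioi n
    · rw [Set.indicator_of_mem hk, poissonMeasure_singleton]
      refine ENNReal.ofReal_le_ofReal ?_
      have h2 : (2 : ℝ) ^ n ≤ 2 ^ k := pow_le_pow_right₀ (by norm_num) (le_of_lt hk)
      rw [mul_pow, div_mul_div_comm, mul_comm (2 ^ n : ℝ), div_le_div_iff₀ (by positivity)
        (by positivity)]
      have : 0 ≤ Real.exp (-l) * l ^ k * k.factorial := by positivity
      nlinarith [mul_le_mul_of_nonneg_left h2 this]
    · rw [Set.indicator_of_notMem hk]; exact zero_le
  exact ENNReal.toReal_le_of_le_ofReal (by positivity) hle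

theorem pointCount_eq_zero_iff {X : Type*} {x : ℕ → X} {B : Set X} :
    pointCount x B = 0 ↔ ∀ i, x i ∉ B := by
  simp [pointCount, Set.encard_eq_zero, Set.eq_empty_iff_forall_notMem]

section Poisson

variable {Ω X : Type*} [MeasurableSpace Ω] [MeasurableSpace X] {P : Measure Ω}
  {ξ : ℕ → Ω → X} {lam : Measure X}

theorem IsPoissonProcess.aemeasurable_pointCount (h : IsPoissonProcess P ξ lam) {B : Set X}
    (hB : MeasurableSet B) (hfin : lam B ≠ ⊤) :
    AEMeasurable (fun ω => pointCount (fun i => ξ i ω) B) P := by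
  -- `Measure.map` is zero by default off the a.e. measurable functions, whereas the law of the
  -- count is a probability.
  refine .of_map_ne_zero ?_
  rw [h.count_law B hB hfin]
  exact IsProbabilityMeasure.ne_zero (poissonMeasure (lam B).toNNReal |>.map (Nat.cast : ℕ → ℕ∞))

theorem IsPoissonProcess.measureReal_pointCount_mem (h : IsPoissonProcess P ξ lam) {B : Set X}
    (hB : MeasurableSet B) (hfin : lam B ≠ ⊤) (s : Set ℕ∞) :
    P.real {ω | pointCount (fun i => ξ i ω) B ∈ s}
      = (poissonMeasure (lam B).toNNReal).real ((fun k : ℕ => (k : ℕ∞)) ⁻¹' s) := by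
  rw [← map_measureReal_apply (by fun_prop) (MeasurableSet.of_discrete (s := s)),
    ← h.count_law B hB hfin, measureReal_def, measureReal_def,
    Measure.map_apply_of_aemeasurable (h.aemeasurable_pointCount hB hfin) .of_discrete]
  rfl

theorem IsPoissonProcess.measureReal_avoid (h : IsPoissonProcess P ξ lam) {B : Set X}
    (hB : MeasurableSet B) (hfin : lam B ≠ ⊤) :
    P.real {ω | ∀ i, ξ i ω ∉ B} = Real.exp (-lam.real B) := by
  have h0 := h.measureReal_pointCount_mem hB hfin {0}
  have hpre : (fun k : ℕ => (k : ℕ∞)) ⁻¹' {0} = {0} := by ext; simp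
  simp only [Set.mem_singleton_iff, pointCount_eq_zero_iff] at h0
  rw [h0, hpre, poissonMeasure_real_singleton]
  simp [measureReal_def, ENNReal.coe_toNNReal_eq_toReal]

theorem IsPoissonProcess.measureReal_lt_pointCount_le (h : IsPoissonProcess P ξ lam) {B : Set X}
    (hB : MeasurableSet B) (hfin : lam B ≠ ⊤) (n : ℕ) :
    P.real {ω | (n : ℕ∞) < pointCount (fun i => ξ i ω) B} ≤ Real.exp (lam.real B) / 2 ^ n := by
  have h0 := h.measureReal_pointCount_mem hB hfin (Set.Ioi n)
  have hpre : (fun k : ℕ => (k : ℕ∞)) ⁻¹' (Set.Ioi n) = Set.Ioi n := by ext; simp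
  simp only [Set.mem_Ioi] at h0
  rw [h0, hpre]
  exact poissonMeasure_real_Ioi_le _ _

theorem IsPoissonProcess.ae_finite (h : IsPoissonProcess P ξ lam) {B : Set X}
    (hB : MeasurableSet B) (hfin : lam B ≠ ⊤) : ∀ᵐ ω ∂P, {i | ξ i ω ∈ B}.Finite := by
  have hm := h.aemeasurable_pointCount hB hfin
  have : ∀ᵐ k ∂(P.map fun ω => pointCount (fun i => ξ i ω) B), k ≠ ⊤ := by
    rw [h.count_law B hB hfin, ae_map_iff (by fun_prop) .of_discrete]
    exact .of_forall fun k => ENat.natCast_ne_top k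
  filter_upwards [ae_of_ae_map hm this] with ω hω
  exact Set.encard_ne_top_iff.1 hω

theorem IsPoissonProcess.ae_avoid (h : IsPoissonProcess P ξ lam) [IsProbabilityMeasure P]
    {B : Set X} (hB : MeasurableSet B) (h0 : lam B = 0) : ∀ᵐ ω ∂P, ∀ i, ξ i ω ∉ B := by
  have h1 := h.measureReal_avoid hB (by simp [h0])
  rw [measureReal_def lam, h0, ENNReal.toReal_zero, neg_zero, Real.exp_zero] at h1
  have hms : MeasurableSet {ω | ∀ i, ξ i ω ∉ B} := by
    simp only [Set.ofPred_forall]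
    exact .iInter fun i => h.measurable i hB.compl
  refine (mem_ae_iff_prob_eq_one hms).2 ?_
  rwa [measureReal_def, ENNReal.toReal_eq_one_iff] at h1

end Poisson

/-! ### Partial maxima, the max-stable law and the error bound -/

variable {d : ℕ}

theorem partialMax_le_iff {n : ℕ} (hn : n ≠ 0) {φ : ℕ → ℝ × (Fin d → ℝ)} {z : Fin d → ℝ} :
    partialMax n φ ≤ z ↔ ∀ i < n, φ i ∉ {p : ℝ × (Fin d → ℝ) | ∃ j, z j < p.1 * p.2 j} := by
  have : Nonempty (Fin n) := Fin.pos_iff_nonempty.1 (Nat.pos_of_ne_zero hn)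
  simp only [Pi.le_def, partialMax, Set.mem_ofPred_eq, not_exists, not_lt]
  constructor
  · intro h i hi j
    exact (le_ciSup (f := fun i : Fin n => (φ i).1 * (φ i).2 j) (Set.finite_range _).bddAbove
      ⟨i, hi⟩).trans (h j)
  · exact fun h j => ciSup_le fun i => h i i.2 j

theorem measurable_partialMax {Ω : Type*} [MeasurableSpace Ω] {η : ℕ → Ω → ℝ × (Fin d → ℝ)}
    (hη : ∀ i, Measurable (η i)) (n : ℕ) :
    Measurable fun ω => partialMax n fun i => η i ω := by
  refine measurable_pi_lambda _ fun j => ?_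
  unfold partialMax
  exact .iSup fun i => by have := hη i; fun_prop

/-- The distribution function of the max-stable law. -/
theorem IsMaxStableLaw.real_Iic {N : Seminorm ℝ (Fin d → ℝ)} (hN : IsReferenceNorm N)
    {α : ℝ} (hα : 0 < α) {ν : Measure (Fin d → ℝ)} (hν : IsAngularMeasure N ν)
    {m : Measure (Fin d → ℝ)} (hm : IsMaxStableLaw α ν m) {z : Fin d → ℝ} (hz : ∀ j, 0 < z j) :
    m.real (Set.Iic z) = Real.exp (-((radialMeasure α).prod (powAngular α ν)).real
      {p | ∃ j, z j < p.1 * p.2 j}) := by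
  have := hν.finite
  obtain ⟨Ω, _, P, _, y, hy, rfl⟩ := hm
  have hBm : MeasurableSet {x : Fin d → ℝ | ∃ j, z j < x j} := by
    simp only [Set.ofPred_exists]
    exact .iUnion fun j => measurableSet_lt measurable_const (by fun_prop)
  have hB : exponentMeasure α ν {x | ∃ j, z j < x j}
      = ((radialMeasure α).prod (powAngular α ν)) {p | ∃ j, z j < p.1 * p.2 j} := by
    rw [exponentMeasure_eq_map, Measure.map_apply (by fun_prop) hBm]
    rfl
  have hfin : exponentMeasure α ν {x | ∃ j, z j < x j} ≠ ⊤ := by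
    rw [hB]; exact hν.prod_radialMeasure_exceed_ne_top hN hα hz
  have hmeas : Measurable fun ω j => ⨆ i : ℕ, y i ω j := by
    refine measurable_pi_lambda _ fun j => .iSup fun i => ?_
    have := hy.measurable i
    fun_prop
  rw [map_measureReal_apply hmeas measurableSet_Iic, measureReal_def _ {p | _}, ← hB,
    ← measureReal_def, ← hy.measureReal_avoid hBm hfin]
  refine measureReal_congr ?_
  filter_upwards [hy.ae_finite hBm hfin] with ω hω
  -- An unbounded real supremum would default to 0. Here only finitely many points exceed `z`.
  have hbdd : ∀ j, BddAbove (Set.range fun i => y i ω j) := by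
    intro j
    obtain ⟨M, hM⟩ := (hω.image fun i => y i ω j).bddAbove
    refine ⟨max M (z j), ?_⟩
    rintro _ ⟨i, rfl⟩
    by_cases h : y i ω ∈ {x : Fin d → ℝ | ∃ j, z j < x j}
    · exact le_max_of_le_left (hM ⟨i, h, rfl⟩)
    · exact le_max_of_le_right (not_lt.1 fun h' => h ⟨j, h'⟩)
  refine propext ?_
  change (∀ j, ⨆ i, y i ω j ≤ z j) ↔ ∀ i, ¬ ∃ j, z j < y i ω j
  push Not
  exact ⟨fun h i j => (le_ciSup (hbdd j) i).trans (h j), fun h j => ciSup_le fun i => h i j⟩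

/-- If the points of a process are ordered by radius and at most `n` of them have a radius larger
than `x`, then all these points are among the first `n` ones. -/
theorem lt_of_pointCount_le {φ : ℕ → ℝ × (Fin d → ℝ)} (hφ : Antitone fun i => (φ i).1) {x : ℝ}
    {n i : ℕ} (hn : pointCount φ {p | x < p.1} ≤ n) (hi : x < (φ i).1) : i < n := by
  by_contra! hni
  -- If `i ≥ n`, the indices `0, …, n` all have radius above `x`: one point too many.
  have hsub : (Finset.range (n + 1) : Set ℕ) ⊆ {k | φ k ∈ {p : ℝ × (Fin d → ℝ) | x < p.1}} := by
    intro k hk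
    have hk' : k < n + 1 := by simpa using hk
    exact hi.trans_le (hφ (by omega))
  have h := (Set.encard_le_encard hsub).trans hn
  rw [Set.encard_coe_eq_coe_finsetCard, Finset.card_range] at h
  have : n + 1 ≤ n := by exact_mod_cast h
  omega

/-- The error of the partial maximum is due to there being more than `n` points of radius larger
than `x`, or no exceedance of `z` by a point of radius larger than `x`. -/
theorem IsLePagePointProcess.abs_sub_le {Ω : Type*} [MeasurableSpace Ω] {P : Measure Ω}
    [IsProbabilityMeasure P] {N : Seminorm ℝ (Fin d → ℝ)} (hN : IsReferenceNorm N)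
    {α : ℝ} (hα : 0 < α) {ν : Measure (Fin d → ℝ)} (hν : IsAngularMeasure N ν)
    {η : ℕ → Ω → ℝ × (Fin d → ℝ)} (hη : IsLePagePointProcess P α ν η)
    {m : Measure (Fin d → ℝ)} (hm : IsMaxStableLaw α ν m) {z : Fin d → ℝ} (hz : ∀ j, 0 < z j)
    {n : ℕ} (hn : n ≠ 0) {x : ℝ} (hx : 0 < x) :
    |(P.map fun ω => partialMax n fun i => η i ω).real (Set.Iic z) - m.real (Set.Iic z)|
      ≤ Real.exp (x ^ (-α) * ν.real Set.univ) / 2 ^ n + Real.exp (-x ^ (-α)) := by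
  have := hν.finite
  set L := (radialMeasure α).prod (powAngular α ν) with hL
  set B : Set (ℝ × (Fin d → ℝ)) := {p | ∃ j, z j < p.1 * p.2 j} with hB
  set R : Set (ℝ × (Fin d → ℝ)) := {p | x < p.1} with hR
  have hBm : MeasurableSet B := measurableSet_exceed z
  have hRm : MeasurableSet R := measurableSet_lt_fst x
  have hBfin : L B ≠ ⊤ := hν.prod_radialMeasure_exceed_ne_top hN hα hz
  have hLR : L R = ENNReal.ofReal (x ^ (-α) * ν.real Set.univ) := prod_radialMeasure_lt_fst hα hx
  have hRfin : L R ≠ ⊤ := by rw [hLR]; exact ENNReal.ofReal_ne_top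
  have hF : MeasurableSet {ω | ∀ i, η i ω ∉ B} := by
    simp only [Set.ofPred_forall]
    exact .iInter fun i => hη.poisson.measurable i hBm.compl
  have hFE : {ω | ∀ i, η i ω ∉ B} ⊆ {ω | ∀ i < n, η i ω ∉ B} := fun ω h i _ => h i
  have hmap : (P.map fun ω => partialMax n fun i => η i ω).real (Set.Iic z)
      = P.real {ω | ∀ i < n, η i ω ∉ B} := by
    rw [map_measureReal_apply (measurable_partialMax hη.poisson.measurable n) measurableSet_Iic]
    congr 1
    ext ω
    exact partialMax_le_iff hn
  have htail : P.real {ω | (n : ℕ∞) < pointCount (fun i => η i ω) R}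
      ≤ Real.exp (x ^ (-α) * ν.real Set.univ) / 2 ^ n := by
    have h := hη.poisson.measureReal_lt_pointCount_le hRm hRfin n
    rwa [measureReal_def L, hLR, ENNReal.toReal_ofReal (by positivity)] at h
  -- The law of `Z` is realized by `η` itself, which turns the difference into the probability of
  -- one event.
  rw [hmap, hm.real_Iic hN hα hν hz, ← hη.poisson.measureReal_avoid hBm hBfin,
    ← measureReal_sdiff hFE hF, abs_of_nonneg measureReal_nonneg]
  by_cases hxz : ∀ j, x ≤ z j
  · have h0 : L (B \ R) = 0 := hν.prod_radialMeasure_exceed_eq_zero hN hα hz hxz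
    refine le_add_of_le_of_nonneg (le_trans ?_ htail) (Real.exp_pos _).le
    refine ENNReal.toReal_mono (measure_ne_top _ _) (measure_mono_ae ?_)
    filter_upwards [hη.ordered, hη.poisson.ae_avoid (hBm.diff hRm) h0] with ω hord hav
    rintro ⟨hE, hnF⟩
    change (n : ℕ∞) < _
    by_contra! hle
    refine hnF fun i hi => hE i ?_ hi
    exact lt_of_pointCount_le hord hle (by by_contra h; exact hav i ⟨hi, h⟩)
  · push Not at hxz
    obtain ⟨j, hj⟩ := hxz
    have hBR : L (B ∩ R) ≠ ⊤ := ne_top_of_le_ne_top hBfin (measure_mono Set.inter_subset_left)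
    have hlow : x ^ (-α) ≤ L.real (B ∩ R) := by
      rw [measureReal_def, ← ENNReal.ofReal_le_iff_le_toReal hBR]
      refine (hν.le_prod_radialMeasure hN hα hx j).trans (measure_mono ?_)
      exact fun p hp => ⟨⟨j, hj.trans hp.2⟩, hp.1⟩
    have hav := hη.poisson.measureReal_avoid (hBm.inter hRm) hBR
    calc P.real ({ω | ∀ i < n, η i ω ∉ B} \ {ω | ∀ i, η i ω ∉ B})
        ≤ P.real ({ω | (n : ℕ∞) < pointCount (fun i => η i ω) R}
            ∪ {ω | ∀ i, η i ω ∉ B ∩ R}) := by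
          refine ENNReal.toReal_mono (measure_ne_top _ _) (measure_mono_ae ?_)
          filter_upwards [hη.ordered] with ω hord
          rintro ⟨hE, -⟩
          by_cases hlt : (n : ℕ∞) < pointCount (fun i => η i ω) R
          · exact Or.inl hlt
          · exact Or.inr fun i hi => hE i (lt_of_pointCount_le hord (not_lt.1 hlt) hi.2) hi.1
      _ ≤ _ := measureReal_union_le _ _
      _ ≤ _ := by
          refine add_le_add htail ?_
          rw [hav]
          exact Real.exp_le_exp.2 (neg_le_neg hlow)

/-! ### From exponential bounds to the stated rate -/

theorem inv_le_two_mul_log_div_rpow {n : ℕ} (hn : 2 ≤ n) :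
    (n : ℝ)⁻¹ ≤ 2 * (Real.log n / n) ^ ((2 : ℝ) / 3) := by
  have hn' : (2 : ℝ) ≤ n := by exact_mod_cast hn
  have hlog : 1 / 2 ≤ Real.log n :=
    (by linarith [Real.log_two_gt_d9] : (1 : ℝ) / 2 ≤ Real.log 2).trans
      (Real.log_le_log (by norm_num) hn')
  have h0 : 0 < Real.log n / n := by positivity
  have h1 : Real.log n / n ≤ 1 :=
    div_le_one_of_le₀ (Real.log_le_self (by positivity)) (by positivity)
  have h2 := Real.rpow_le_rpow_of_exponent_ge h0 h1 (by norm_num : (2 : ℝ) / 3 ≤ 1)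
  rw [Real.rpow_one] at h2
  have h3 : (n : ℝ)⁻¹ * (1 / 2) ≤ Real.log n / n := by
    rw [div_eq_inv_mul (Real.log n)]
    exact mul_le_mul_of_nonneg_left hlog (by positivity)
  linarith

theorem exp_neg_le_inv {t : ℝ} (ht : 0 < t) : Real.exp (-t) ≤ t⁻¹ := by
  rw [Real.exp_neg]
  exact inv_anti₀ ht (by linarith [Real.add_one_le_exp t])

theorem exp_quarter_div_two_pow_le {n : ℕ} (hn : 0 < n) :
    Real.exp (n / 4) / 2 ^ n ≤ 4 * (n : ℝ)⁻¹ := by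
  have hn' : (0 : ℝ) < n := by exact_mod_cast hn
  have h2 : (2 : ℝ) ^ n = Real.exp (n * Real.log 2) := by
    rw [Real.exp_nat_mul, Real.exp_log (by norm_num)]
  calc Real.exp (n / 4) / 2 ^ n ≤ Real.exp (-(n / 4)) := by
        rw [h2, ← Real.exp_sub, Real.exp_le_exp]
        -- Uses `log 2 > 1/2`.
        nlinarith [Real.log_two_gt_d9]
    _ ≤ (n / 4 : ℝ)⁻¹ := exp_neg_le_inv (by positivity)
    _ = 4 * (n : ℝ)⁻¹ := by rw [inv_div, div_eq_mul_inv]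

end LePage

theorem mainTheorem3 (d : ℕ) (hd : 1 ≤ d) (κ : ℝ) :
    ∃ C : ℝ, 0 < C ∧
      ∀ (N : Seminorm ℝ (Fin d → ℝ)), LePage.IsReferenceNorm N →
      (∀ j, N (Pi.single j 1) ≤ κ) →
      ∀ (α : ℝ), 0 < α →
      ∀ (ν : Measure (Fin d → ℝ)), LePage.IsAngularMeasure N ν →
      ∀ (Ω : Type*) [MeasurableSpace Ω] (P : Measure Ω) [IsProbabilityMeasure P]
        (η : ℕ → Ω → ℝ × (Fin d → ℝ)), LePage.IsLePagePointProcess P α ν η →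
      ∀ (Ω' : Type*) [MeasurableSpace Ω'] (P' : Measure Ω') [IsProbabilityMeasure P']
        (Z : Ω' → Fin d → ℝ), Measurable Z → LePage.IsMaxStableLaw α ν (P'.map Z) →
      LePage.HasBoundedDensity (P'.map Z) →
      ∀ n : ℕ, 2 ≤ n →
        LePage.dKol (P.map (fun ω => LePage.partialMax n (fun i => η i ω))) (P'.map Z)
          ≤ C * (Real.log n / n) ^ ((2 : ℝ) / 3) := by
  obtain ⟨K, hK, hκK⟩ : ∃ K : ℝ, 0 < K ∧ κ * d ≤ K :=
    ⟨|κ * d| + 1, by positivity, (le_abs_self _).trans (by linarith)⟩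
  refine ⟨8 + 8 * K, by positivity, ?_⟩
  intro N hN hNκ α hα ν hν Ω _ P _ η hη Ω' _ P' _ Z _ hm _ n hn
  have hn0 : (0 : ℝ) < n := by exact_mod_cast (by omega : 0 < n)
  have hbound : LePage.dKol (P.map (fun ω => LePage.partialMax n (fun i => η i ω))) (P'.map Z)
      ≤ (4 + 4 * K) * (n : ℝ)⁻¹ := by
    refine Real.iSup_le (fun z => ?_) (by positivity)
    -- This `x` gives `x^(-α) = n / (4K)`; since the angular mass is at most `K`, the mean number of
    -- radii above `x` is at most `n/4`.
    have h := hη.abs_sub_le hN hα hν hm z.2 (by omega : n ≠ 0)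
      (x := (n / (4 * K)) ^ (-α⁻¹)) (by positivity)
    have hpow : ((n / (4 * K) : ℝ) ^ (-α⁻¹)) ^ (-α) = n / (4 * K) := by
      rw [← Real.rpow_mul (by positivity), neg_mul_neg, inv_mul_cancel₀ hα.ne', Real.rpow_one]
    rw [hpow] at h
    have hmass : n / (4 * K) * ν.real Set.univ ≤ n / 4 := by
      calc n / (4 * K) * ν.real Set.univ ≤ n / (4 * K) * K :=
            mul_le_mul_of_nonneg_left ((hν.real_univ_le hNκ).trans hκK) (by positivity)
        _ = n / 4 := by field_simp
    have h1 : Real.exp (n / (4 * K) * ν.real Set.univ) / 2 ^ n ≤ 4 * (n : ℝ)⁻¹ :=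
      (div_le_div_of_nonneg_right (Real.exp_le_exp.2 hmass) (by positivity)).trans
        (LePage.exp_quarter_div_two_pow_le (by omega))
    have h2 : Real.exp (-(n / (4 * K))) ≤ 4 * K * (n : ℝ)⁻¹ := by
      refine (LePage.exp_neg_le_inv (by positivity)).trans_eq ?_
      rw [inv_div, div_eq_mul_inv]
    linarith
  calc _ ≤ (4 + 4 * K) * (n : ℝ)⁻¹ := hbound
    _ ≤ (4 + 4 * K) * (2 * (Real.log n / n) ^ ((2 : ℝ) / 3)) :=
      mul_le_mul_of_nonneg_left (LePage.inv_le_two_mul_log_div_rpow hn) (by positivity)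
    _ = (8 + 8 * K) * (Real.log n / n) ^ ((2 : ℝ) / 3) := by ring
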